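/- Let $r\ge 3$ and $d_1,\dots,d_r\ge 1$ be integers, $d=\sum_{j=1}^r d_j$ (so $d\ge 3$), and let $q_1,\dots,q_d$ be pairwise coprime positive integers, $\Gamma=q_1\mathbb Z\oplus\cdots\oplus q_d\mathbb Z$, $Q=q_1\cdots q_d$. Write $n=(n_1,\dots,n_d)\in\mathbb Z^d$ as $n=(\tilde n_1,\dots,\tilde n_r)$, where $\tilde n_j\in\mathbb Z^{d_j}$ are the consecutive blocks of coordinates of lengths $d_1,\dots,d_r$. A function $V:\mathbb Z^d\to\mathbb C$ is called $(d_1,\dots,d_{r-1})\oplus d_r$-separable if there are functions $V_j:\mathbb Z^{d_j+d_r}\to\mathbb C$, $1\le j\le r-1$, with $$V(n)=\sum_{j=1}^{r-1}V_j(\tilde n_j,\tilde n_r)\qquad\text{for all } n\in\mathbb Z^d .$$ For a $\Gamma$-periodic $V$ and $k\in\mathbb R^d$, let $D_V(k)$ be the $Q\times Q$ matrix of the operator $\Delta+V$, where $(\Delta u)(n)=\sum_{\|n'-n\|_1=1}u(n')$, on the $Q$-dimensional space of functions $u:\mathbb Z^d\to\mathbb C$ satisfying $u(n+q_j\mathbf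 e_j)=e^{2\pi \mathbf i k_j}u(n)$ for $1\le j\le d$, in the basis of those functions whose restrictions to $W=\{n: 0\le n_j\le q_j-1\}$ are the indicators of single points. Let $P_V(k,\lambda)=\det(D_V(k)-\lambda I)$. Given a non-empty $S\subset\{1,\dots,d\}$ and $\lambda_1,\lambda_2\in\mathbb C$, functions $V$ and $Y$ are called generalized partially Fermi isospectral with respect to $(S,\lambda_1,\lambda_2)$ if there are $k_j^*\in\mathbb R$ for $j\notin S$ such that $P_V(k,\lambda_1)=P_Y(k,\lambda_2)$ for every $k\in\mathbb R^d$ with $k_j=k_j^*$ for all $j\notin S$. **Theorem.** Let $V$ and $Y$ be real-valued $\Gamma$-periodic functions on $\mathbb Z^d$, and let $V$ be $(d_1,\dots,d_{r-1})\oplus d_r$-separable. Suppose that for all $1\le i<m\le r-1$, every coordinate index $s$ in the $i$-th block and every coordinate index $t$ in the $m$-th block, there exist $\lambda_1,\lambda_2\in\mathbb C$ and $S\subset\{1,\dots,d\}$ (all allowed to depend on $s,t$) with $s,t\in S$ and $\#S\ge 3$ such that $V$ and $Y$ are generalized partially Fermi isospectral with respect to $(S,\lambda_1,\lambda_2)$.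 Then $Y$ is also $(d_1,\dots,d_{r-1})\oplus d_r$-separable. -/

import Mathlib

noncomputable section

namespace DiscreteFloquet

/-- A function `V` on `ℤ^d` is `Γ`-periodic, `Γ = q₁ℤ ⊕ ⋯ ⊕ q_dℤ`. -/
def IsPeriodic {d : ℕ} (q : Fin d → ℕ) (V : (Fin d → ℤ) → ℂ) : Prop :=
  ∀ (j : Fin d) (n : Fin d → ℤ), V (n + Pi.single j (q j : ℤ)) = V n

/-- The discrete Laplacian on `ℤ^d`: the sum over the `2d` nearest neighbours. -/
def laplacian {d : ℕ} (u : (Fin d → ℤ) → ℂ) (n : Fin d → ℤ) : ℂ :=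
  ∑ j : Fin d, (u (n + Pi.single j 1) + u (n - Pi.single j 1))

/-- The fundamental domain `W = {n : 0 ≤ n_j ≤ q_j - 1}` of `Γ`; it has `Q = q₁ ⋯ q_d` elements. -/
abbrev Cell {d : ℕ} (q : Fin d → ℕ) : Type := (j : Fin d) → Fin (q j)

/-- A point of the fundamental domain as a point of `ℤ^d`. -/
def Cell.toLattice {d : ℕ} {q : Fin d → ℕ} (w : Cell q) : Fin d → ℤ := fun j => ((w j : ℕ) : ℤ)

/-- The unique function `u` on `ℤ^d` that satisfies the Floquet-Bloch boundary condition
`u (n + q_j e_j) = exp (2πi k_j) u n` and equals on the fundamental domain the indicator of `w`.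
(`/` and `%` are the floor quotient and the remainder of integers.) -/
def floquetBasis {d : ℕ} (q : Fin d → ℕ) (k : Fin d → ℝ) (w : Cell q) (n : Fin d → ℤ) : ℂ :=
  if ∀ j, n j % (q j : ℤ) = w.toLattice j then
    Complex.exp (2 * (Real.pi : ℂ) * Complex.I *
      ∑ j : Fin d, (k j : ℂ) * ((n j / (q j : ℤ) : ℤ) : ℂ))
  else 0

/-- The `Q × Q` Floquet matrix `D_V(k)`: the matrix of `Δ + V` on the functions satisfying the
Floquet-Bloch boundary condition with quasi-momentum `k`, in the basis `floquetBasis q k`. -/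
def floquetMatrix {d : ℕ} (q : Fin d → ℕ) (V : (Fin d → ℤ) → ℂ) (k : Fin d → ℝ) :
    Matrix (Cell q) (Cell q) ℂ :=
  Matrix.of fun n w =>
    laplacian (floquetBasis q k w) n.toLattice + V n.toLattice * floquetBasis q k w n.toLattice

/-- `P_V(k, μ) = det (D_V(k) - μ I)`. -/
def floquetDet {d : ℕ} (q : Fin d → ℕ) (V : (Fin d → ℤ) → ℂ) (k : Fin d → ℝ) (μ : ℂ) : ℂ :=
  (floquetMatrix q V k - μ • (1 : Matrix (Cell q) (Cell q) ℂ)).det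

/-- `V` and `Y` are generalized partially Fermi isospectral, with respect to the set `S` of free
quasi-momenta and the energies `μ₁`, `μ₂`: for some fixed real values `kstar j` of the coordinates
`j ∉ S`, one has `P_V(k, μ₁) = P_Y(k, μ₂)` for all real values of the coordinates `k j`, `j ∈ S`. -/
def IsGenPartiallyFermiIsospectral {d : ℕ} (q : Fin d → ℕ) (S : Finset (Fin d)) (μ₁ μ₂ : ℂ)
    (V Y : (Fin d → ℤ) → ℂ) : Prop :=
  S.Nonempty ∧ ∃ kstar : Fin d → ℝ, ∀ k : Fin d → ℝ, (∀ j, j ∉ S → k j = kstar j) →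
    floquetDet q V k μ₁ = floquetDet q Y k μ₂

/-- The `a`-th coordinate of the `m`-th block, when the `d₀ + ⋯ + d_{r-1}` coordinates are cut
into consecutive blocks of lengths `d₀, …, d_{r-1}`: it is the coordinate number
`d₀ + ⋯ + d_{m-1} + a` (everything counted from zero). -/
def blockIndex {r : ℕ} (ds : Fin r → ℕ) (m : Fin r) (a : Fin (ds m)) : Fin (∑ j, ds j) :=
  finSigmaFinEquiv ⟨m, a⟩

/-- The `m`-th block of the coordinates of `n`. -/
def block {r : ℕ} (ds : Fin r → ℕ) (n : Fin (∑ j, ds j) → ℤ) (m : Fin r) : Fin (ds m) → ℤ :=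
  fun a => n (blockIndex ds m a)

/-- With `r = p + 1` blocks: `V` is `(d₁, …, d_{r-1}) ⊕ d_r`-separable if it is a sum, over the
first `r - 1` blocks, of functions of that block and of the last block. -/
def IsOplusSeparable {p : ℕ} (ds : Fin (p + 1) → ℕ) (V : (Fin (∑ j, ds j) → ℤ) → ℂ) : Prop :=
  ∃ F : (j : Fin p) → (Fin (ds j.castSucc) → ℤ) → (Fin (ds (Fin.last p)) → ℤ) → ℂ,
    ∀ n, V n = ∑ j : Fin p, F j (block ds n j.castSucc) (block ds n (Fin.last p))

end DiscreteFloquet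

end

noncomputable section

namespace DiscreteFloquet

/-! By Fourier inversion, a periodic function is separable exactly when its coefficients vanish at
every frequency that is non-zero in two coordinates `s`, `t` from different blocks among the first
`p` (`IsOplusSeparable.fourierCoeff_eq_zero`, `isOplusSeparable_of_fourierCoeff`). So fix such `s`,
`t`, a third coordinate `u` of `S` and such a frequency `m`; the coefficient of `Y` at `m` has to
vanish.

In the basis of exponentials the Floquet matrix is a diagonal (the dispersion) plus a convolution
(the potential). Its determinant is a Laurent polynomial in the multipliers `z`, so isospectrality
extends from the unit torus to non-zero complex `z` (`det_fourierMatrix_eq_of_torus`). Put `z = ε⁻¹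
v + w` in the coordinates `s, t, u` and let `ε → 0`: only the frequencies `l` with `∑ v_j ρ_j ^ l_j
= 0` keep an interaction in the limit (`det_boundedBlock_eq`). With `v` chosen so that `0` and `m`
qualify, coprimality of the periods leaves only frequencies that agree with `0` or with `m` in these
three coordinates (`agree_of_det_eq_zero`), and `w` shifts the two groups by independent scalars
`x`, `y`.

For `V` the determinant factors over the two groups; for `Y` they are coupled by a block `C` and its
adjoint. Equality for all `x`, `y` forces `tr (Cᴴ C) = 0` (`offDiag_eq_zero_of_det_eq`), and one
entry of `C` is the conjugate of the coefficient in question. -/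

/-- The primitive root of unity `exp (2πi / q_j)`. -/
def cellRoot {d : ℕ} (q : Fin d → ℕ) (j : Fin d) : ℂ :=
  Complex.exp (2 * Real.pi * Complex.I / q j)

/-- The character `n ↦ exp (2πi ∑ m_j n_j / q_j)` of `ℤ^d`. -/
def latticeChar {d : ℕ} (q : Fin d → ℕ) (m n : Fin d → ℤ) : ℂ :=
  ∏ j, cellRoot q j ^ (m j * n j)

/-- The Fourier coefficient of `V`, averaged over the fundamental domain. -/
def fourierCoeff {d : ℕ} (q : Fin d → ℕ) (V : (Fin d → ℤ) → ℂ) (m : Fin d → ℤ) : ℂ :=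
  (∏ j, (q j : ℂ))⁻¹ * ∑ w : Cell q, V w.toLattice * latticeChar q (-m) w.toLattice

/-! ### Characters and Fourier inversion on the fundamental domain -/

section Characters

variable {d : ℕ} {q : Fin d → ℕ}

lemma cellRoot_isPrimitiveRoot (hq : ∀ j, 0 < q j) (j : Fin d) :
    IsPrimitiveRoot (cellRoot q j) (q j) :=
  Complex.isPrimitiveRoot_exp _ (hq j).ne'

lemma cellRoot_ne_zero (j : Fin d) : cellRoot q j ≠ 0 := Complex.exp_ne_zero _

lemma norm_cellRoot (j : Fin d) : ‖cellRoot q j‖ = 1 := by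
  rw [cellRoot, Complex.norm_exp]
  simp [Complex.div_re]

lemma latticeChar_comm (m n : Fin d → ℤ) : latticeChar q m n = latticeChar q n m := by
  simp only [latticeChar, mul_comm]

lemma latticeChar_add_left (m m' n : Fin d → ℤ) :
    latticeChar q (m + m') n = latticeChar q m n * latticeChar q m' n := by
  simp only [latticeChar, ← Finset.prod_mul_distrib, Pi.add_apply, add_mul,
    zpow_add₀ (cellRoot_ne_zero _)]

lemma latticeChar_neg_left (m n : Fin d → ℤ) :
    latticeChar q (-m) n = (latticeChar q m n)⁻¹ := by
  simp only [latticeChar, ← Finset.prod_inv_distrib, Pi.neg_apply, neg_mul, zpow_neg]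

lemma latticeChar_neg_right (m n : Fin d → ℤ) :
    latticeChar q m (-n) = latticeChar q (-m) n := by
  simp only [latticeChar, Pi.neg_apply, neg_mul, mul_neg]

lemma star_latticeChar (m n : Fin d → ℤ) :
    star (latticeChar q m n) = latticeChar q (-m) n := by
  have h : ‖latticeChar q m n‖ = 1 := by
    simp [latticeChar, norm_prod, norm_zpow, norm_cellRoot]
  rw [latticeChar_neg_left, Complex.inv_eq_conj h]
  rfl

lemma sum_zpow_cellRoot (hq : ∀ j, 0 < q j) (j : Fin d) (a : ℤ) :
    ∑ x : Fin (q j), cellRoot q j ^ (a * ((x : ℕ) : ℤ)) =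
      if (q j : ℤ) ∣ a then (q j : ℂ) else 0 := by
  have hp := cellRoot_isPrimitiveRoot hq j
  have h1 : ∀ x : Fin (q j), cellRoot q j ^ (a * ((x : ℕ) : ℤ)) =
      (cellRoot q j ^ a) ^ (x : ℕ) := fun x => by rw [zpow_mul, zpow_natCast]
  simp only [h1]
  rw [Fin.sum_univ_eq_sum_range fun x => (cellRoot q j ^ a) ^ x]
  split_ifs with h
  · rw [(hp.zpow_eq_one_iff_dvd a).2 h]
    simp
  · have h2 : cellRoot q j ^ a ≠ 1 := fun h' => h ((hp.zpow_eq_one_iff_dvd a).1 h')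
    have h3 : (cellRoot q j ^ a) ^ (q j) = 1 := by
      rw [← zpow_natCast, ← zpow_mul, mul_comm, zpow_mul, zpow_natCast, hp.pow_eq_one, one_zpow]
    rw [geom_sum_eq h2, h3, sub_self, zero_div]

lemma sum_latticeChar (hq : ∀ j, 0 < q j) (m : Fin d → ℤ) :
    ∑ w : Cell q, latticeChar q m w.toLattice =
      if ∀ j, (q j : ℤ) ∣ m j then ∏ j, (q j : ℂ) else 0 := by
  have h : ∑ w : Cell q, latticeChar q m w.toLattice =
      ∏ j, ∑ x : Fin (q j), cellRoot q j ^ (m j * ((x : ℕ) : ℤ)) := by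
    rw [Fintype.prod_sum]
    rfl
  rw [h]
  simp only [sum_zpow_cellRoot hq]
  split_ifs with h1
  · exact Finset.prod_congr rfl fun j _ => if_pos (h1 j)
  · push Not at h1
    obtain ⟨j, hj⟩ := h1
    exact Finset.prod_eq_zero (Finset.mem_univ j) (if_neg hj)

lemma prod_period_ne_zero (hq : ∀ j, 0 < q j) : ∏ j, (q j : ℂ) ≠ 0 :=
  Finset.prod_ne_zero_iff.2 fun j _ => Nat.cast_ne_zero.2 (hq j).ne'

lemma Cell.dvd_sub_iff {w w' : Cell q} :
    (∀ j, (q j : ℤ) ∣ w.toLattice j - w'.toLattice j) ↔ w = w' := by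
  constructor
  · intro h
    funext j
    have h2 := Int.ModEq.eq ((Int.modEq_iff_dvd.2 (h j)).symm)
    have h3 := Int.ofNat_lt.2 (w j).isLt
    have h4 := Int.ofNat_lt.2 (w' j).isLt
    simp only [Cell.toLattice] at h2
    rw [Int.emod_eq_of_lt (Int.natCast_nonneg _) h3, Int.emod_eq_of_lt (Int.natCast_nonneg _) h4] at h2
    exact Fin.ext (by exact_mod_cast h2)
  · rintro rfl
    simp

lemma sum_latticeChar_sub (hq : ∀ j, 0 < q j) (w w' : Cell q) :
    ∑ l : Cell q, latticeChar q l.toLattice (w.toLattice - w'.toLattice) =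
      if w = w' then ∏ j, (q j : ℂ) else 0 := by
  simp only [latticeChar_comm _ (w.toLattice - w'.toLattice), sum_latticeChar hq, Pi.sub_apply,
    Cell.dvd_sub_iff]

/-- Fourier inversion on the fundamental domain, shifted by `m`. -/
lemma sum_fourierCoeff_sub (hq : ∀ j, 0 < q j) (V : (Fin d → ℤ) → ℂ) (m : Fin d → ℤ)
    (w : Cell q) :
    ∑ l : Cell q, fourierCoeff q V (l.toLattice - m) * latticeChar q l.toLattice w.toLattice =
      V w.toLattice * latticeChar q m w.toLattice := by
  have h : ∀ l w' : Cell q, latticeChar q (-(l.toLattice - m)) w'.toLattice *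
      latticeChar q l.toLattice w.toLattice =
      latticeChar q m w'.toLattice * latticeChar q l.toLattice (w.toLattice - w'.toLattice) := by
    intro l w'
    rw [neg_sub, sub_eq_add_neg, latticeChar_add_left, sub_eq_add_neg w.toLattice,
      latticeChar_comm _ (w.toLattice + _), latticeChar_add_left,
      latticeChar_comm _ l.toLattice, latticeChar_comm (-w'.toLattice), latticeChar_neg_right]
    ring
  simp only [fourierCoeff, mul_assoc, Finset.sum_mul, ← Finset.mul_sum, h]
  rw [Finset.sum_comm]
  simp only [← Finset.mul_sum, sum_latticeChar_sub hq, mul_ite, mul_zero, Finset.sum_ite_eq,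
    Finset.mem_univ, if_true]
  field_simp [prod_period_ne_zero hq]

/-- Realness enters through this symmetry: it makes the two off-diagonal blocks for `Y` adjoint to
each other. -/
lemma star_fourierCoeff (V : (Fin d → ℤ) → ℂ) (hV : ∀ n, (V n).im = 0) (m : Fin d → ℤ) :
    star (fourierCoeff q V m) = fourierCoeff q V (-m) := by
  have h : ∀ n, star (V n) = V n := fun n => Complex.conj_eq_iff_im.2 (hV n)
  simp [fourierCoeff, star_sum, star_prod, h, star_latticeChar, -Complex.star_def, star_inv₀]

/-- `finRotate` is the cyclic successor; the wrap-around from `N - 1` to `0` is invisible because `ρ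
^ N = 1`. -/
lemma zpow_mul_finRotate {N : ℕ} {ρ : ℂ} (hρ : ρ ≠ 0) (hN : ρ ^ N = 1) (a : ℤ) (x : Fin N) :
    ρ ^ (a * ((finRotate N x : ℕ) : ℤ)) = ρ ^ (a * ((x : ℕ) : ℤ)) * ρ ^ a := by
  cases N with
  | zero => exact x.elim0
  | succ N =>
    rw [coe_finRotate, ← zpow_add₀ hρ]
    split_ifs with h
    · subst h
      have : a * ((Fin.last N : ℕ) : ℤ) + a = ((N + 1 : ℕ) : ℤ) * a := by
        push_cast [Fin.val_last]
        ring
      rw [this, zpow_mul ρ ((N + 1 : ℕ) : ℤ), zpow_natCast, hN, one_zpow]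
      simp
    · push_cast
      ring_nf

/-- A function that does not depend on the coordinate `s` has no Fourier coefficients that are
non-zero in that coordinate. -/
lemma fourierCoeff_eq_zero_of_indep (hq : ∀ j, 0 < q j) (V : (Fin d → ℤ) → ℂ) (s : Fin d)
    (hV : ∀ (n : Fin d → ℤ) (a : ℤ), V (Function.update n s a) = V n) (m : Fin d → ℤ) (hm : ¬ (q s : ℤ) ∣ m s) :
    fourierCoeff q V m = 0 := by
  -- Rotating the coordinate `s` preserves the sum that defines the coefficient, but also multiplies
  -- it by `ρ_s ^ (-m_s) ≠ 1`.
  let σ : Equiv.Perm (Cell q) :=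
    Equiv.piCongrRight fun j => if j = s then finRotate (q j) else Equiv.refl _
  have hσV : ∀ w : Cell q, V (σ w).toLattice = V w.toLattice := by
    intro w
    rw [← hV w.toLattice ((σ w).toLattice s)]
    congr 1
    funext j
    by_cases h : j = s
    · subst h
      simp
    · simp [h, σ, Cell.toLattice]
  have hσχ : ∀ w : Cell q, latticeChar q (-m) (σ w).toLattice =
      latticeChar q (-m) w.toLattice * cellRoot q s ^ (-m s) := by
    intro w
    rw [← Fintype.prod_ite_eq s fun j => cellRoot q j ^ (-m j), latticeChar, latticeChar,
      ← Finset.prod_mul_distrib]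
    refine Finset.prod_congr rfl fun j _ => ?_
    by_cases h : s = j
    · subst h
      simpa [σ, Cell.toLattice] using zpow_mul_finRotate (cellRoot_ne_zero s)
        (cellRoot_isPrimitiveRoot hq s).pow_eq_one (-m s) (w s)
    · simp [h, Ne.symm h, σ, Cell.toLattice]
  have hsum : ∑ w : Cell q, V w.toLattice * latticeChar q (-m) w.toLattice =
      (∑ w : Cell q, V w.toLattice * latticeChar q (-m) w.toLattice) *
        cellRoot q s ^ (-m s) := by
    rw [Finset.sum_mul, ← Equiv.sum_comp σ fun w : Cell q =>
      V w.toLattice * latticeChar q (-m) w.toLattice]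
    exact Finset.sum_congr rfl fun w _ => by rw [hσV, hσχ, mul_assoc]
  have hne : cellRoot q s ^ (-m s) ≠ 1 := fun h =>
    hm (dvd_neg.1 (((cellRoot_isPrimitiveRoot hq s).zpow_eq_one_iff_dvd _).1 h))
  rw [fourierCoeff, eq_zero_of_mul_eq_self_right hne hsum.symm, mul_zero]

end Characters

/-! ### The Floquet matrix in the basis of exponentials -/

/-- The symbol of the Laplacian at the lattice frequency `l` and the complex quasi-momentum `z`. -/
def dispersion {d : ℕ} (q : Fin d → ℕ) (z : Fin d → ℂ) (l : Cell q) : ℂ :=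
  ∑ j, (z j * cellRoot q j ^ l.toLattice j + (z j * cellRoot q j ^ l.toLattice j)⁻¹)

/-- The matrix of `Δ + V - μ` in the basis of exponentials, at the complex quasi-momentum `z`. -/
def fourierMatrix {d : ℕ} (q : Fin d → ℕ) (V : (Fin d → ℤ) → ℂ) (z : Fin d → ℂ) (μ : ℂ) :
    Matrix (Cell q) (Cell q) ℂ :=
  Matrix.of fun l l' => fourierCoeff q V (l.toLattice - l'.toLattice) +
    if l = l' then dispersion q z l - μ else 0

/-- The exponential `n ↦ ∏ j, (z_j ρ_j ^ l_j) ^ n_j`. -/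
def floquetExp {d : ℕ} (q : Fin d → ℕ) (z : Fin d → ℂ) (l n : Fin d → ℤ) : ℂ :=
  ∏ j, (z j * cellRoot q j ^ l j) ^ n j

/-- The multiplier `exp (2πi k_j / q_j)` of a unit translation. -/
def quasiMultiplier {d : ℕ} (q : Fin d → ℕ) (k : Fin d → ℝ) (j : Fin d) : ℂ :=
  Complex.exp (2 * Real.pi * Complex.I * k j / q j)

section FourierMatrix

variable {d : ℕ} {q : Fin d → ℕ}

/-- The point of the fundamental domain that is congruent to `n`. -/
def cellMod (hq : ∀ j, 0 < q j) (n : Fin d → ℤ) : Cell q := fun j =>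
  ⟨(n j % (q j : ℤ)).toNat, by
    have h : (0 : ℤ) < q j := by exact_mod_cast hq j
    have := Int.emod_lt_of_pos (n j) h
    have := Int.emod_nonneg (n j) h.ne'
    lia⟩

lemma cellMod_toLattice (hq : ∀ j, 0 < q j) (n : Fin d → ℤ) (j : Fin d) :
    (cellMod hq n).toLattice j = n j % (q j : ℤ) := by
  have h : (0 : ℤ) < q j := by exact_mod_cast hq j
  exact Int.toNat_of_nonneg (Int.emod_nonneg (n j) h.ne')

lemma eq_cellMod_iff (hq : ∀ j, 0 < q j) (n : Fin d → ℤ) (w : Cell q) :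
    (∀ j, n j % (q j : ℤ) = w.toLattice j) ↔ cellMod hq n = w := by
  simp only [← cellMod_toLattice hq]
  constructor
  · intro h
    funext j
    exact Fin.ext (Int.ofNat_inj.1 (h j))
  · rintro rfl j
    rfl

lemma quasiMultiplier_ne_zero (k : Fin d → ℝ) (j : Fin d) : quasiMultiplier q k j ≠ 0 :=
  Complex.exp_ne_zero _

lemma floquetExp_eq_mul (z : Fin d → ℂ) (l n : Fin d → ℤ) :
    floquetExp q z l n = (∏ j, z j ^ n j) * latticeChar q l n := by
  simp only [floquetExp, latticeChar, ← Finset.prod_mul_distrib, mul_zpow, zpow_mul]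

lemma floquetExp_add {z : Fin d → ℂ} (hz : ∀ j, z j ≠ 0) (l n n' : Fin d → ℤ) :
    floquetExp q z l (n + n') = floquetExp q z l n * floquetExp q z l n' := by
  simp only [floquetExp, ← Finset.prod_mul_distrib, Pi.add_apply]
  exact Finset.prod_congr rfl fun j _ =>
    zpow_add₀ (mul_ne_zero (hz j) (zpow_ne_zero _ (cellRoot_ne_zero j))) _ _

lemma floquetExp_single (z : Fin d → ℂ) (l : Fin d → ℤ) (j : Fin d) (a : ℤ) :
    floquetExp q z l (Pi.single j a) = (z j * cellRoot q j ^ l j) ^ a := by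
  rw [floquetExp, Finset.prod_eq_single j]
  · simp
  · intro i _ hi
    simp [hi]
  · simp

lemma laplacian_floquetExp {z : Fin d → ℂ} (hz : ∀ j, z j ≠ 0) (l : Cell q) (n : Fin d → ℤ) :
    laplacian (floquetExp q z l.toLattice) n =
      floquetExp q z l.toLattice n * dispersion q z l := by
  rw [laplacian, dispersion, Finset.mul_sum]
  refine Finset.sum_congr rfl fun j _ => ?_
  rw [sub_eq_add_neg, ← Pi.single_neg, floquetExp_add hz, floquetExp_add hz, floquetExp_single,
    floquetExp_single, zpow_one, zpow_neg_one, mul_add]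

/-- The `q_j`-th power of `z_j ρ_j ^ l_j` is `exp (2πi k_j)` for every `l`, so all these
exponentials obey the same boundary condition. -/
lemma floquetExp_quasiMultiplier (hq : ∀ j, 0 < q j) (k : Fin d → ℝ) (l n : Fin d → ℤ) :
    floquetExp q (quasiMultiplier q k) l n =
      Complex.exp (2 * (Real.pi : ℂ) * Complex.I *
        ∑ j : Fin d, (k j : ℂ) * ((n j / (q j : ℤ) : ℤ) : ℂ)) *
      floquetExp q (quasiMultiplier q k) l (cellMod hq n).toLattice := by
  rw [Finset.mul_sum, Complex.exp_sum, floquetExp, floquetExp, ← Finset.prod_mul_distrib]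
  refine Finset.prod_congr rfl fun j _ => ?_
  have hne : quasiMultiplier q k j * cellRoot q j ^ l j ≠ 0 :=
    mul_ne_zero (Complex.exp_ne_zero _) (zpow_ne_zero _ (cellRoot_ne_zero j))
  have hq' : (q j : ℂ) ≠ 0 := Nat.cast_ne_zero.2 (hq j).ne'
  conv_lhs => rw [← Int.mul_ediv_add_emod (n j) (q j), zpow_add₀ hne, zpow_mul, zpow_natCast]
  rw [cellMod_toLattice, mul_pow, ← zpow_natCast (cellRoot q j ^ l j), ← zpow_mul,
    mul_comm (l j), zpow_mul, zpow_natCast, (cellRoot_isPrimitiveRoot hq j).pow_eq_one, one_zpow,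
    mul_one, quasiMultiplier, ← Complex.exp_nat_mul, ← Complex.exp_int_mul]
  congr 2
  field_simp

/-- A Floquet function is the combination of the basis functions given by its values on the
fundamental domain. -/
lemma sum_floquetBasis_mul (hq : ∀ j, 0 < q j) (k : Fin d → ℝ) (l n : Fin d → ℤ) :
    ∑ w : Cell q, floquetBasis q k w n * floquetExp q (quasiMultiplier q k) l w.toLattice =
      floquetExp q (quasiMultiplier q k) l n := by
  simp only [floquetBasis, eq_cellMod_iff hq, ite_mul, zero_mul, Finset.sum_ite_eq,
    Finset.mem_univ, if_true]
  exact (floquetExp_quasiMultiplier hq k l n).symm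

lemma sum_laplacian_floquetBasis_mul (hq : ∀ j, 0 < q j) (k : Fin d → ℝ) (l n : Fin d → ℤ) :
    ∑ w : Cell q, laplacian (floquetBasis q k w) n *
        floquetExp q (quasiMultiplier q k) l w.toLattice =
      laplacian (floquetExp q (quasiMultiplier q k) l) n := by
  simp only [laplacian, Finset.sum_mul, add_mul]
  rw [Finset.sum_comm]
  simp only [Finset.sum_add_distrib, sum_floquetBasis_mul hq]

/-- The Floquet determinant, computed in the basis of exponentials. -/
theorem floquetDet_eq_det_fourierMatrix (hq : ∀ j, 0 < q j) (V : (Fin d → ℤ) → ℂ)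
    (k : Fin d → ℝ) (μ : ℂ) :
    floquetDet q V k μ = (fourierMatrix q V (quasiMultiplier q k) μ).det := by
  set z := quasiMultiplier q k with hz
  have hz0 : ∀ j, z j ≠ 0 := quasiMultiplier_ne_zero k
  let U : Matrix (Cell q) (Cell q) ℂ :=
    Matrix.of fun n l => floquetExp q z l.toLattice n.toLattice
  -- The inverse of `U`, by orthogonality of characters after removing the factor `∏ z_j ^ n_j`; it
  -- serves only to show `U.det ≠ 0`.
  let G : Matrix (Cell q) (Cell q) ℂ := Matrix.of fun l n =>
    (∏ j, (q j : ℂ))⁻¹ * (latticeChar q l.toLattice (-n.toLattice) * (∏ j, z j ^ n.toLattice j)⁻¹)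
  have hUG : U * G = 1 := by
    ext n n'
    have h1 : ∀ l : Cell q, U n l * G l n' = ((∏ j, (q j : ℂ))⁻¹ * (∏ j, z j ^ n.toLattice j) *
        (∏ j, z j ^ n'.toLattice j)⁻¹) *
        latticeChar q l.toLattice (n.toLattice - n'.toLattice) := by
      intro l
      simp only [U, G, Matrix.of_apply, floquetExp_eq_mul]
      rw [sub_eq_add_neg, latticeChar_comm _ (_ + _), latticeChar_add_left,
        latticeChar_comm n.toLattice, latticeChar_comm (-n'.toLattice)]
      ring
    rw [Matrix.mul_apply]
    simp only [h1, ← Finset.mul_sum, sum_latticeChar_sub hq, Matrix.one_apply]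
    split_ifs with h
    · subst h
      have h2 : ∏ j, z j ^ n.toLattice j ≠ 0 :=
        Finset.prod_ne_zero_iff.2 fun j _ => zpow_ne_zero _ (hz0 j)
      have h3 := prod_period_ne_zero hq
      field_simp
    · simp
  have hU : U.det ≠ 0 := by
    intro h
    have := congrArg Matrix.det hUG
    rw [Matrix.det_mul, h, zero_mul, Matrix.det_one] at this
    exact zero_ne_one this
  -- The columns of `U` are Floquet exponentials: the Laplacian scales each by its dispersion, and
  -- multiplication by `V` becomes convolution with the Fourier coefficients.
  have hint : (floquetMatrix q V k - μ • (1 : Matrix (Cell q) (Cell q) ℂ)) * U =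
      U * fourierMatrix q V z μ := by
    ext n l
    have h1 : (floquetMatrix q V k * U) n l =
        U n l * dispersion q z l + V n.toLattice * U n l := by
      rw [Matrix.mul_apply]
      simp only [floquetMatrix, U, Matrix.of_apply, add_mul, Finset.sum_add_distrib, mul_assoc,
        ← Finset.mul_sum]
      rw [hz, sum_laplacian_floquetBasis_mul hq, sum_floquetBasis_mul hq,
        laplacian_floquetExp (quasiMultiplier_ne_zero k)]
    have h2 : ∑ l' : Cell q, U n l' * fourierCoeff q V (l'.toLattice - l.toLattice) =
        V n.toLattice * U n l := by
      simp only [U, Matrix.of_apply, floquetExp_eq_mul]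
      rw [mul_left_comm, ← sum_fourierCoeff_sub hq, Finset.mul_sum]
      exact Finset.sum_congr rfl fun l' _ => by ring
    rw [Matrix.sub_mul, Matrix.sub_apply, h1, Matrix.smul_mul, Matrix.one_mul, Matrix.smul_apply,
      Matrix.mul_apply]
    simp only [fourierMatrix, Matrix.of_apply, mul_add, Finset.sum_add_distrib, h2, mul_ite,
      mul_zero, Finset.sum_ite_eq', Finset.mem_univ, if_true, smul_eq_mul]
    ring
  have hdet := congrArg Matrix.det hint
  rw [Matrix.det_mul, Matrix.det_mul, mul_comm] at hdet
  exact mul_left_cancel₀ hU hdet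

end FourierMatrix

/-! ### From the unit torus to non-zero complex quasi-momenta -/

section TorusExtension

open MvPolynomial

variable {d : ℕ} {q : Fin d → ℕ}

/-- Each variable in `T` has at most a simple pole, which the factor `∏ z_j` clears; coordinates
outside `T` contribute constants. -/
lemma exists_mvPolynomial_dispersion (T : Finset (Fin d)) (ζ : Fin d → ℂ) (l : Cell q) :
    ∃ p : MvPolynomial (Fin d) ℂ, ∀ z : Fin d → ℂ, (∀ j ∈ T, z j ≠ 0) →
      eval z p = (∏ j ∈ T, z j) * dispersion q (T.piecewise z ζ) l := by
  have h : ∀ j, ∃ p : MvPolynomial (Fin d) ℂ, ∀ z : Fin d → ℂ, (∀ j ∈ T, z j ≠ 0) →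
      eval z p = (∏ j ∈ T, z j) * (T.piecewise z ζ j * cellRoot q j ^ l.toLattice j +
        (T.piecewise z ζ j * cellRoot q j ^ l.toLattice j)⁻¹) := by
    intro j
    by_cases hj : j ∈ T
    · refine ⟨C (cellRoot q j ^ l.toLattice j) * X j * ∏ i ∈ T, X i +
        C (cellRoot q j ^ l.toLattice j)⁻¹ * ∏ i ∈ T.erase j, X i, fun z hz => ?_⟩
      have h1 := hz j hj
      have h2 : cellRoot q j ^ l.toLattice j ≠ 0 := zpow_ne_zero _ (cellRoot_ne_zero j)
      simp only [map_add, map_mul, eval_C, eval_X, map_prod, Finset.piecewise_eq_of_mem _ _ _ hj,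
        ← Finset.mul_prod_erase T z hj]
      field_simp
    · refine ⟨C (ζ j * cellRoot q j ^ l.toLattice j + (ζ j * cellRoot q j ^ l.toLattice j)⁻¹) *
        ∏ i ∈ T, X i, fun z _ => ?_⟩
      simp only [map_mul, eval_C, eval_X, map_prod, Finset.piecewise_eq_of_notMem _ _ _ hj]
      ring
  choose p hp using h
  refine ⟨∑ j, p j, fun z hz => ?_⟩
  rw [map_sum, dispersion, Finset.mul_sum]
  exact Finset.sum_congr rfl fun j _ => hp j z hz

lemma exists_mvPolynomial_det_fourierMatrix (V : (Fin d → ℤ) → ℂ) (μ : ℂ) (T : Finset (Fin d))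
    (ζ : Fin d → ℂ) :
    ∃ p : MvPolynomial (Fin d) ℂ, ∀ z : Fin d → ℂ, (∀ j ∈ T, z j ≠ 0) →
      eval z p = (∏ j ∈ T, z j) ^ Fintype.card (Cell q) *
        (fourierMatrix q V (T.piecewise z ζ) μ).det := by
  choose p hp using exists_mvPolynomial_dispersion (q := q) T ζ
  let M : Matrix (Cell q) (Cell q) (MvPolynomial (Fin d) ℂ) := Matrix.of fun l l' =>
    (∏ j ∈ T, X j) * C (fourierCoeff q V (l.toLattice - l'.toLattice)) +
      if l = l' then p l - C μ * ∏ j ∈ T, X j else 0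
  refine ⟨M.det, fun z hz => ?_⟩
  rw [RingHom.map_det, ← Matrix.det_smul]
  congr 1
  ext l l'
  simp only [RingHom.mapMatrix_apply, Matrix.map_apply, M, Matrix.of_apply, Matrix.smul_apply,
    fourierMatrix, map_add, map_mul, map_prod, eval_X, eval_C, apply_ite (eval z), map_sub,
    hp l z hz, map_zero, smul_eq_mul, mul_add, mul_ite, mul_zero]
  split_ifs <;> ring

lemma infinite_unitCircle : Set.Infinite {z : ℂ | ‖z‖ = 1} := by
  refine Set.infinite_of_injOn_mapsTo (s := Set.Ioc (-Real.pi) Real.pi)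
    (f := fun x : ℝ => Complex.exp (x * Complex.I)) (fun x hx y hy hxy => ?_) (fun x _ => ?_)
    (Set.Ioc_infinite (by linarith [Real.pi_pos]))
  · have h := congrArg Complex.arg hxy
    simp only [Complex.exp_mul_I] at h
    rwa [Complex.arg_cos_add_sin_mul_I hx, Complex.arg_cos_add_sin_mul_I hy] at h
  · exact Complex.norm_exp_ofReal_mul_I x

/-- An identity between the determinants at two potentials extends from the unit torus to all
non-zero complex quasi-momenta. -/
theorem det_fourierMatrix_eq_of_torus {V Y : (Fin d → ℤ) → ℂ} {μ₁ μ₂ : ℂ} {T : Finset (Fin d)}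
    {ζ : Fin d → ℂ}
    (h : ∀ z : Fin d → ℂ, (∀ j ∈ T, ‖z j‖ = 1) →
      (fourierMatrix q V (T.piecewise z ζ) μ₁).det = (fourierMatrix q Y (T.piecewise z ζ) μ₂).det)
    (z : Fin d → ℂ) (hz : ∀ j ∈ T, z j ≠ 0) :
    (fourierMatrix q V (T.piecewise z ζ) μ₁).det =
      (fourierMatrix q Y (T.piecewise z ζ) μ₂).det := by
  obtain ⟨p, hp⟩ := exists_mvPolynomial_det_fourierMatrix (q := q) V μ₁ T ζ
  obtain ⟨p', hp'⟩ := exists_mvPolynomial_det_fourierMatrix (q := q) Y μ₂ T ζ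
  have hpp : p = p' := by
    -- Two polynomials that agree on a product of infinite sets are equal.
    refine funext_set (fun _ => {z : ℂ | ‖z‖ = 1}) (fun _ => infinite_unitCircle) fun x hx => ?_
    have h1 : ∀ j, ‖x j‖ = 1 := fun j => hx j (Set.mem_univ j)
    have h2 : ∀ j ∈ T, x j ≠ 0 := fun j _ => norm_ne_zero_iff.1 (by rw [h1 j]; exact one_ne_zero)
    rw [hp x h2, hp' x h2, h x fun j _ => h1 j]
  have h0 : (∏ j ∈ T, z j) ^ Fintype.card (Cell q) ≠ 0 :=
    pow_ne_zero _ (Finset.prod_ne_zero_iff.2 hz)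
  exact mul_left_cancel₀ h0 (by rw [← hp z hz, ← hp' z hz, hpp])

end TorusExtension

/-! ### Which frequencies annihilate the leading form -/

section Triangle

/-- Two non-degenerate triangles inscribed in the unit circle that are related by an affine map
`w ↦ a + b w` with `b ≠ 0` are related by a rotation. -/
lemma eq_zero_of_affine_unitCircle {a b : ℂ} (hb : b ≠ 0) {x y w : ℂ} (hxy : x ≠ y) (hxw : x ≠ w)
    (hyw : y ≠ w) (hx : ‖x‖ = 1) (hy : ‖y‖ = 1) (hw : ‖w‖ = 1) (hx' : ‖a + b * x‖ = 1)
    (hy' : ‖a + b * y‖ = 1) (hw' : ‖a + b * w‖ = 1) : a = 0 := by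
  -- Multiply `|a + b u|² = 1` by `u` and use `u ū = 1`. The resulting quadratic has three distinct
  -- roots, so its leading coefficient `ā b` vanishes.
  have key : ∀ u : ℂ, ‖u‖ = 1 → ‖a + b * u‖ = 1 →
      star a * b * u ^ 2 + (a * star a + b * star b - 1) * u + a * star b = 0 := by
    intro u hu hu'
    have h1 : u * star u = 1 := by
      have := Complex.mul_conj' u
      rw [hu] at this
      simpa using this
    have h2 : (a + b * u) * star (a + b * u) = 1 := by
      have := Complex.mul_conj' (a + b * u)
      rw [hu'] at this
      simpa using this
    rw [star_add, star_mul'] at h2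
    linear_combination u * h2 - (a * star b + b * star b * u) * h1
  have hx1 := key x hx hx'
  have hy1 := key y hy hy'
  have hw1 := key w hw hw'
  have e1 : star a * b * (x + y) + (a * star a + b * star b - 1) = 0 :=
    mul_left_cancel₀ (sub_ne_zero.2 hxy) (by linear_combination hx1 - hy1)
  have e2 : star a * b * (x + w) + (a * star a + b * star b - 1) = 0 :=
    mul_left_cancel₀ (sub_ne_zero.2 hxw) (by linear_combination hx1 - hw1)
  have e3 : star a * b = 0 :=
    mul_left_cancel₀ (sub_ne_zero.2 hyw) (by linear_combination e1 - e2)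
  simpa [hb] using e3

variable {d : ℕ} {q : Fin d → ℕ}

lemma norm_cellRoot_zpow (j : Fin d) (a : ℤ) : ‖cellRoot q j ^ a‖ = 1 := by
  rw [norm_zpow, norm_cellRoot, one_zpow]

lemma cellRoot_zpow_pow (hq : ∀ j, 0 < q j) (j : Fin d) (a : ℤ) :
    (cellRoot q j ^ a) ^ q j = 1 := by
  rw [← zpow_natCast, ← zpow_mul, mul_comm, zpow_mul, zpow_natCast,
    (cellRoot_isPrimitiveRoot hq j).pow_eq_one, one_zpow]

lemma eq_one_of_pow_eq_one_of_coprime {a b : ℕ} (h : a.Coprime b) {x : ℂ} (ha : x ^ a = 1)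
    (hb : x ^ b = 1) : x = 1 := by
  have := pow_gcd_eq_one.2 ⟨ha, hb⟩
  rwa [h.gcd_eq_one, pow_one] at this

lemma Cell.cellRoot_zpow_inj (hq : ∀ j, 0 < q j) {l m : Cell q} {j : Fin d}
    (h : cellRoot q j ^ l.toLattice j = cellRoot q j ^ m.toLattice j) : l j = m j := by
  simp only [Cell.toLattice, zpow_natCast] at h
  exact Fin.ext ((cellRoot_isPrimitiveRoot hq j).pow_inj (l j).isLt (m j).isLt h)

/-- A common value would be a root of unity of two coprime orders, hence `1`, which `m_s ≠ 0`
excludes. Nothing is needed of `m_t`, so the third coordinate `u` may have `m_u = 0`. -/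
lemma cellRoot_zpow_ne (hq : ∀ j, 0 < q j) (hcop : ∀ i j, i ≠ j → (q i).Coprime (q j))
    {m : Cell q} {s t : Fin d} (hst : s ≠ t) (hs : m.toLattice s ≠ 0) :
    cellRoot q s ^ m.toLattice s ≠ cellRoot q t ^ m.toLattice t := by
  intro h
  have h1 : cellRoot q s ^ m.toLattice s = 1 :=
    eq_one_of_pow_eq_one_of_coprime (hcop s t hst) (cellRoot_zpow_pow hq s _)
      (by rw [h]; exact cellRoot_zpow_pow hq t _)
  simp only [Cell.toLattice, zpow_natCast] at h1 hs
  rw [(cellRoot_isPrimitiveRoot hq s).pow_eq_one_iff_dvd] at h1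
  exact hs (by exact_mod_cast Nat.eq_zero_of_dvd_of_lt h1 (m s).isLt)

/-- The linear form attached to `l` vanishes on the common kernel of those attached to `0` and `m`
only if `l` agrees with `0` or with `m`. -/
theorem agree_of_det_eq_zero (hq : ∀ j, 0 < q j) (hcop : ∀ i j, i ≠ j → (q i).Coprime (q j))
    {s t u : Fin d} (hst : s ≠ t) (hsu : s ≠ u) (htu : t ≠ u) {m l : Cell q}
    (hs : m.toLattice s ≠ 0) (ht : m.toLattice t ≠ 0)
    (h : cellRoot q s ^ l.toLattice s *
        (cellRoot q t ^ m.toLattice t - cellRoot q u ^ m.toLattice u) +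
      cellRoot q t ^ l.toLattice t *
        (cellRoot q u ^ m.toLattice u - cellRoot q s ^ m.toLattice s) +
      cellRoot q u ^ l.toLattice u *
        (cellRoot q s ^ m.toLattice s - cellRoot q t ^ m.toLattice t) = 0) :
    (l.toLattice s = 0 ∧ l.toLattice t = 0 ∧ l.toLattice u = 0) ∨
      (l s = m s ∧ l t = m t ∧ l u = m u) := by
  have d1 := cellRoot_zpow_ne hq hcop hst hs
  have d2 := cellRoot_zpow_ne hq hcop hsu hs
  have d3 := cellRoot_zpow_ne hq hcop htu ht
  have ps := cellRoot_zpow_pow hq s (l.toLattice s)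
  have pt := cellRoot_zpow_pow hq t (l.toLattice t)
  have pu := cellRoot_zpow_pow hq u (l.toLattice u)
  have hzero : ∀ j, cellRoot q j ^ l.toLattice j = 1 → l.toLattice j = 0 := by
    intro j hj
    simp only [Cell.toLattice, zpow_natCast] at hj ⊢
    rw [(cellRoot_isPrimitiveRoot hq j).pow_eq_one_iff_dvd] at hj
    exact_mod_cast Nat.eq_zero_of_dvd_of_lt hj (l j).isLt
  have ns := norm_cellRoot_zpow (q := q) s (l.toLattice s)
  have nt := norm_cellRoot_zpow (q := q) t (l.toLattice t)
  have nu := norm_cellRoot_zpow (q := q) u (l.toLattice u)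
  have qs := cellRoot_zpow_pow hq s (m.toLattice s)
  have qt := cellRoot_zpow_pow hq t (m.toLattice t)
  have is := Cell.cellRoot_zpow_inj hq (l := l) (m := m) (j := s)
  have it := Cell.cellRoot_zpow_inj hq (l := l) (m := m) (j := t)
  have iu := Cell.cellRoot_zpow_inj hq (l := l) (m := m) (j := u)
  have ms := norm_cellRoot_zpow (q := q) s (m.toLattice s)
  have mt := norm_cellRoot_zpow (q := q) t (m.toLattice t)
  have mu := norm_cellRoot_zpow (q := q) u (m.toLattice u)
  have zs := hzero s
  have zt := hzero t
  have zu := hzero u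
  clear hzero
  generalize cellRoot q s ^ l.toLattice s = ηs at *
  generalize cellRoot q t ^ l.toLattice t = ηt at *
  generalize cellRoot q u ^ l.toLattice u = ηu at *
  generalize cellRoot q s ^ m.toLattice s = ωs at *
  generalize cellRoot q t ^ m.toLattice t = ωt at *
  generalize cellRoot q u ^ m.toLattice u = ωu at *
  have d1' := sub_ne_zero.2 d1
  -- The affine map `w ↦ a + b w` through `(ωs, ηs)` and `(ωt, ηt)`; the hypothesis `h` says exactly
  -- that it also sends `ωu` to `ηu`.
  obtain ⟨b, hb⟩ : ∃ b, b = (ηs - ηt) / (ωs - ωt) := ⟨_, rfl⟩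
  obtain ⟨a, ha⟩ : ∃ a, a = ηs - b * ωs := ⟨_, rfl⟩
  have hb' : b * (ωs - ωt) = ηs - ηt := by rw [hb, div_mul_cancel₀ _ d1']
  have es : ηs = a + b * ωs := by rw [ha]; ring
  have et : ηt = a + b * ωt := by rw [ha]; linear_combination hb'
  have eu : ηu = a + b * ωu :=
    mul_left_cancel₀ d1' (by rw [es, et] at h; linear_combination h)
  -- If `b = 0`, the three `η` coincide, and coprimality makes their common value `1`. Otherwise
  -- three points of the unit circle stay on it, so `a = 0`, and `b = ηs / ωs = ηt / ωt` is a root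
  -- of unity of two coprime orders.
  by_cases hb0 : b = 0
  · left
    have hst' : ηs = ηt := by rw [es, et, hb0]; ring
    have hsu' : ηs = ηu := by rw [es, eu, hb0]; ring
    have h1 : ηs = 1 := eq_one_of_pow_eq_one_of_coprime (hcop s t hst) ps (by rwa [hst'])
    exact ⟨zs h1, zt (hst' ▸ h1), zu (hsu' ▸ h1)⟩
  · right
    have ha0 : a = 0 := eq_zero_of_affine_unitCircle hb0 d1 d2 d3 ms mt mu (es ▸ ns) (et ▸ nt)
      (eu ▸ nu)
    rw [ha0, zero_add] at es et eu
    have hb1 : b = 1 := by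
      refine eq_one_of_pow_eq_one_of_coprime (hcop s t hst) ?_ ?_
      · rw [es, mul_pow, qs, mul_one] at ps
        exact ps
      · rw [et, mul_pow, qt, mul_one] at pt
        exact pt
    rw [hb1, one_mul] at es et eu
    exact ⟨is es, it et, iu eu⟩

end Triangle

/-! ### A rigidity property of block determinants -/

section BlockDeterminant

open Matrix Polynomial Filter Topology ComplexOrder

lemma eval_charpoly_neg {α : Type*} [Fintype α] [DecidableEq α] (A : Matrix α α ℂ) (x : ℂ) :
    (-A).charpoly.eval x = (scalar α x + A).det := by
  rw [Matrix.eval_charpoly, sub_neg_eq_add]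

lemma eq_of_smul_monic_eval_eq {p p' : ℂ[X]} (hp : p.Monic) (hp' : p'.Monic) {a b : ℂ}
    (ha : b ≠ 0) (h : ∀ y, a * p.eval y = b * p'.eval y) : a = b ∧ p = p' := by
  have h1 : C a * p = C b * p' := Polynomial.funext fun y => by simpa using h y
  have h2 : a = b := by
    have := congrArg Polynomial.leadingCoeff h1
    simpa [Polynomial.leadingCoeff_mul, hp.leadingCoeff, hp'.leadingCoeff] using this
  refine ⟨h2, ?_⟩
  subst h2
  exact mul_left_cancel₀ (by simpa using ha) h1

lemma trace_eq_of_charpoly_neg_eq {α : Type*} [Fintype α] [DecidableEq α]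
    {A B : Matrix α α ℂ} (h : (-A).charpoly = (-B).charpoly) : A.trace = B.trace := by
  cases isEmpty_or_nonempty α
  · simp [Matrix.trace]
  · have h1 := trace_eq_neg_charpoly_coeff (-A)
    rw [h, ← trace_eq_neg_charpoly_coeff (-B)] at h1
    simpa using h1

/-- If the determinant of a block matrix with off-diagonal blocks `C`, `Cᴴ` factors as the one of
a block diagonal matrix with the same diagonal up to a constant, then `C = 0`. -/
theorem offDiag_eq_zero_of_det_eq {α β : Type*} [Fintype α] [DecidableEq α] [Fintype β]
    [DecidableEq β] [Nonempty α] (A A' : Matrix α α ℂ) (B B' : Matrix β β ℂ) (C : Matrix α β ℂ)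
    (δ : ℂ) (hA : A'.trace = A.trace + Fintype.card α * δ)
    (hB : B'.trace = B.trace + Fintype.card β * δ)
    (h : ∀ x y : ℂ, (scalar α x + A').det * (scalar β y + B').det =
      (fromBlocks (scalar α x + A) C Cᴴ (scalar β y + B)).det) : C = 0 := by
  -- Schur complement: for fixed `x` both sides are constants times monic polynomials in `y`, so the
  -- constants and the polynomials agree separately.
  have key : ∀ x : ℂ, (scalar α x + A).det ≠ 0 →
      (scalar α x + A').det = (scalar α x + A).det ∧
      (-B').charpoly = (-(B - Cᴴ * (scalar α x + A)⁻¹ * C)).charpoly := by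
    intro x hx
    refine eq_of_smul_monic_eval_eq (charpoly_monic _) (charpoly_monic _) hx fun y => ?_
    have hu : IsUnit (scalar α x + A).det := isUnit_iff_ne_zero.2 hx
    let := (scalar α x + A).invertibleOfIsUnitDet hu
    rw [eval_charpoly_neg, eval_charpoly_neg, h, det_fromBlocks₁₁, invOf_eq_nonsing_inv,
      add_sub_assoc]
  have hchar : (-A').charpoly = (-A).charpoly := by
    -- The factor `(-A).charpoly` absorbs the finitely many `x` at which the Schur complement is
    -- unavailable.
    have h0 : (-A).charpoly * ((-A').charpoly - (-A).charpoly) = 0 := by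
      refine Polynomial.funext fun x => ?_
      rw [eval_mul, eval_sub, eval_charpoly_neg, eval_charpoly_neg, eval_zero]
      by_cases hx : (scalar α x + A).det = 0
      · rw [hx, zero_mul]
      · rw [(key x hx).1, sub_self, mul_zero]
    rcases mul_eq_zero.1 h0 with h1 | h1
    · exact absurd h1 (charpoly_monic _).ne_zero
    · exact sub_eq_zero.1 h1
  have hδ : δ = 0 := by
    have := trace_eq_of_charpoly_neg_eq hchar
    rw [hA] at this
    simpa using this
  -- With `δ = 0`, comparing traces in `key` leaves `tr (Cᴴ (x + A)⁻¹ C) = 0`; clearing the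
  -- determinant gives the adjugate.
  have htr : ∀ x : ℂ, (scalar α x + A).det ≠ 0 →
      (Cᴴ * (scalar α x + A).adjugate * C).trace = 0 := by
    intro x hx
    have h1 := trace_eq_of_charpoly_neg_eq (key x hx).2
    rw [hB, hδ, mul_zero, add_zero, trace_sub, eq_comm, sub_eq_self, inv_def, Matrix.mul_smul,
      Matrix.smul_mul, trace_smul, smul_eq_mul] at h1
    rcases mul_eq_zero.1 h1 with h2 | h2
    · exact absurd h2 (by rwa [Ring.inverse_eq_inv', inv_eq_zero])
    · exact h2
  -- Substituting `x = ε⁻¹` and rescaling, the adjugate of `1 + ε A` tends to the identity, which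
  -- isolates `tr (Cᴴ C)`.
  have hcont : Continuous fun ε : ℂ => (1 + ε • A : Matrix α α ℂ) := by fun_prop
  have hev : ∀ᶠ ε : ℂ in 𝓝[≠] 0, (Cᴴ * (1 + ε • A).adjugate * C).trace = 0 := by
    have h1 : ∀ᶠ ε : ℂ in 𝓝 0, (1 + ε • A).det ≠ 0 :=
      (hcont.matrix_det.continuousAt (x := (0 : ℂ))).eventually_ne (by simp)
    filter_upwards [h1.filter_mono nhdsWithin_le_nhds, self_mem_nhdsWithin] with ε h2 h3
    have h3 : ε ≠ 0 := h3
    have h4 : (1 + ε • A : Matrix α α ℂ) = ε • (scalar α ε⁻¹ + A) := by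
      rw [smul_add, Matrix.scalar_apply, ← Matrix.smul_one_eq_diagonal, smul_smul,
        mul_inv_cancel₀ h3, one_smul]
    have h5 : (scalar α ε⁻¹ + A).det ≠ 0 := by
      intro h5
      rw [h4, det_smul, h5, mul_zero] at h2
      exact h2 rfl
    rw [h4, adjugate_smul, Matrix.mul_smul, Matrix.smul_mul, trace_smul, htr _ h5, smul_zero]
  have hlim : Tendsto (fun ε : ℂ => (Cᴴ * (1 + ε • A).adjugate * C).trace) (𝓝[≠] 0)
      (𝓝 (Cᴴ * (1 + (0 : ℂ) • A).adjugate * C).trace) := by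
    have : Continuous fun ε : ℂ => (Cᴴ * (1 + ε • A).adjugate * C).trace :=
      ((continuous_const.matrix_mul hcont.matrix_adjugate).matrix_mul
        continuous_const).matrix_trace
    exact (this.tendsto 0).mono_left nhdsWithin_le_nhds
  have h0 := tendsto_nhds_unique (hlim.congr' hev) tendsto_const_nhds
  rw [zero_smul, add_zero, adjugate_one, Matrix.mul_one] at h0
  exact trace_conjTranspose_mul_self_eq_zero_iff.1 h0

end BlockDeterminant

/-! ### The limit of large quasi-momenta -/

section Asymptotics

open Filter Topology

variable {d : ℕ} {q : Fin d → ℕ}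

/-- The linear form in the variables `v_j`, `j ∈ T`, that is the leading part of the dispersion. -/
def leadingForm (q : Fin d → ℕ) (T : Finset (Fin d)) (v : Fin d → ℂ) (l : Cell q) : ℂ :=
  ∑ j ∈ T, v j * cellRoot q j ^ l.toLattice j

/-- The contribution to the dispersion of the coordinates outside `T`. -/
def frozenPart (q : Fin d → ℕ) (T : Finset (Fin d)) (ζ : Fin d → ℂ) (l : Cell q) : ℂ :=
  ∑ j ∈ Tᶜ, (ζ j * cellRoot q j ^ l.toLattice j + (ζ j * cellRoot q j ^ l.toLattice j)⁻¹)

/-- The part of the matrix of `Δ + V - μ` that stays bounded when the quasi-momentum goes to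
infinity in the direction `v`, starting from `w`. -/
def boundedBlock (q : Fin d → ℕ) (V : (Fin d → ℤ) → ℂ) (μ : ℂ) (T : Finset (Fin d))
    (ζ v w : Fin d → ℂ) :
    Matrix {l : Cell q // leadingForm q T v l = 0} {l : Cell q // leadingForm q T v l = 0} ℂ :=
  Matrix.of fun l l' => fourierCoeff q V (l.1.toLattice - l'.1.toLattice) +
    if l = l' then leadingForm q T w l + frozenPart q T ζ l - μ else 0

/-- Only `ε ≠ 0` is needed: if `v_j + ε w_j = 0`, the inverses on both sides are `0` by convention.
-/
lemma dispersion_ray {T : Finset (Fin d)} {ζ v w : Fin d → ℂ} (l : Cell q) {ε : ℂ} (hε : ε ≠ 0) :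
    dispersion q (T.piecewise (fun j => ε⁻¹ * v j + w j) ζ) l =
      ε⁻¹ * leadingForm q T v l + leadingForm q T w l + frozenPart q T ζ l +
        ∑ j ∈ T, ε * ((v j + ε * w j) * cellRoot q j ^ l.toLattice j)⁻¹ := by
  have h1 : ∀ j ∈ T, (T.piecewise (fun j => ε⁻¹ * v j + w j) ζ j * cellRoot q j ^ l.toLattice j +
      (T.piecewise (fun j => ε⁻¹ * v j + w j) ζ j * cellRoot q j ^ l.toLattice j)⁻¹) =
      ε⁻¹ * (v j * cellRoot q j ^ l.toLattice j) + w j * cellRoot q j ^ l.toLattice j +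
        ε * ((v j + ε * w j) * cellRoot q j ^ l.toLattice j)⁻¹ := by
    intro j hj
    have h2 : ε⁻¹ * v j + w j = ε⁻¹ * (v j + ε * w j) := by field_simp
    rw [Finset.piecewise_eq_of_mem _ _ _ hj]
    congr 1
    · ring
    · rw [h2, mul_assoc, mul_inv, inv_inv]
  have h2 : ∀ j ∈ Tᶜ, (T.piecewise (fun j => ε⁻¹ * v j + w j) ζ j * cellRoot q j ^ l.toLattice j +
      (T.piecewise (fun j => ε⁻¹ * v j + w j) ζ j * cellRoot q j ^ l.toLattice j)⁻¹) =
      ζ j * cellRoot q j ^ l.toLattice j + (ζ j * cellRoot q j ^ l.toLattice j)⁻¹ := by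
    intro j hj
    rw [Finset.piecewise_eq_of_notMem _ _ _ (Finset.mem_compl.1 hj)]
  rw [dispersion, ← Finset.sum_add_sum_compl T, Finset.sum_congr rfl h1, Finset.sum_congr rfl h2,
    Finset.sum_add_distrib, Finset.sum_add_distrib, ← Finset.mul_sum]
  simp only [leadingForm, frozenPart]
  ring

lemma tendsto_remainder {T : Finset (Fin d)} {v : Fin d → ℂ} (hv : ∀ j ∈ T, v j ≠ 0)
    (w : Fin d → ℂ) (l : Cell q) :
    Tendsto (fun ε : ℂ => ∑ j ∈ T, ε * ((v j + ε * w j) * cellRoot q j ^ l.toLattice j)⁻¹)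
      (𝓝[≠] 0) (𝓝 0) := by
  rw [← Finset.sum_const_zero (s := T)]
  refine (tendsto_finsetSum T fun j hj => ?_).mono_left nhdsWithin_le_nhds
  have h1 : ContinuousAt
      (fun ε : ℂ => ε * ((v j + ε * w j) * cellRoot q j ^ l.toLattice j)⁻¹) 0 := by
    refine continuousAt_id.mul (ContinuousAt.inv₀ (by fun_prop) ?_)
    rw [zero_mul, add_zero]
    exact mul_ne_zero (hv j hj) (zpow_ne_zero _ (cellRoot_ne_zero j))
  simpa using h1.tendsto

lemma tendsto_dispersion_of_eq_zero {T : Finset (Fin d)} {v : Fin d → ℂ} (hv : ∀ j ∈ T, v j ≠ 0)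
    (ζ w : Fin d → ℂ) {l : Cell q} (hl : leadingForm q T v l = 0) :
    Tendsto (fun ε : ℂ => dispersion q (T.piecewise (fun j => ε⁻¹ * v j + w j) ζ) l)
      (𝓝[≠] 0) (𝓝 (leadingForm q T w l + frozenPart q T ζ l)) := by
  have h := (tendsto_remainder hv w l).const_add (leadingForm q T w l + frozenPart q T ζ l)
  rw [add_zero] at h
  refine h.congr' ?_
  filter_upwards [self_mem_nhdsWithin] with ε hε
  rw [dispersion_ray l hε, hl, mul_zero, zero_add]

lemma tendsto_mul_dispersion {T : Finset (Fin d)} {v : Fin d → ℂ} (hv : ∀ j ∈ T, v j ≠ 0)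
    (ζ w : Fin d → ℂ) (l : Cell q) :
    Tendsto (fun ε : ℂ => ε * dispersion q (T.piecewise (fun j => ε⁻¹ * v j + w j) ζ) l)
      (𝓝[≠] 0) (𝓝 (leadingForm q T v l)) := by
  have hid : Tendsto (fun ε : ℂ => ε) (𝓝[≠] 0) (𝓝 0) := tendsto_id.mono_left nhdsWithin_le_nhds
  have h := ((hid.mul ((tendsto_remainder hv w l).const_add
    (leadingForm q T w l + frozenPart q T ζ l))).const_add (leadingForm q T v l))
  rw [zero_mul, add_zero] at h
  refine h.congr' ?_
  filter_upwards [self_mem_nhdsWithin] with ε hε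
  have hε : ε ≠ 0 := hε
  rw [dispersion_ray l hε]
  field_simp
  ring

-- Rows with non-zero leading form are scaled by `ε` and become diagonal in the limit, while the
-- other rows converge unscaled. The limit matrix `L` is thus block triangular.
open Classical in
lemma tendsto_det_fourierMatrix (V : (Fin d → ℤ) → ℂ) (μ : ℂ) {T : Finset (Fin d)}
    {v : Fin d → ℂ} (hv : ∀ j ∈ T, v j ≠ 0) (ζ w : Fin d → ℂ) :
    Tendsto (fun ε : ℂ =>
        (∏ l : Cell q, if leadingForm q T v l = 0 then 1 else ε) *
          (fourierMatrix q V (T.piecewise (fun j => ε⁻¹ * v j + w j) ζ) μ).det)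
      (𝓝[≠] 0)
      (𝓝 ((boundedBlock q V μ T ζ v w).det *
        ∏ l : {l : Cell q // ¬ leadingForm q T v l = 0}, leadingForm q T v l)) := by
  let L : Matrix (Cell q) (Cell q) ℂ := Matrix.of fun l l' =>
    if leadingForm q T v l = 0 then fourierCoeff q V (l.toLattice - l'.toLattice) +
      (if l = l' then leadingForm q T w l + frozenPart q T ζ l - μ else 0)
    else if l = l' then leadingForm q T v l else 0
  have hL : L.det = (boundedBlock q V μ T ζ v w).det *
      ∏ l : {l : Cell q // ¬ leadingForm q T v l = 0}, leadingForm q T v l := by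
    rw [Matrix.twoBlockTriangular_det L (fun l => leadingForm q T v l = 0)]
    · congr 1
      · congr 1
        ext l l'
        simp [Matrix.toSquareBlockProp, L, boundedBlock, l.2, Subtype.ext_iff]
      · rw [← Matrix.det_diagonal]
        congr 1
        ext l l'
        simp [Matrix.toSquareBlockProp, L, l.2, Subtype.ext_iff, Matrix.diagonal_apply]
    · intro l hl l' hl'
      have : l ≠ l' := fun h => hl (h ▸ hl')
      simp [L, hl, this]
  have hid : Tendsto (fun ε : ℂ => ε) (𝓝[≠] 0) (𝓝 0) := tendsto_id.mono_left nhdsWithin_le_nhds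
  rw [← hL]
  simp only [← Matrix.det_diagonal, ← Matrix.det_mul]
  refine ((Continuous.matrix_det continuous_id).tendsto L).comp ?_
  refine tendsto_pi_nhds.2 fun l => tendsto_pi_nhds.2 fun l' => ?_
  simp only [Matrix.diagonal_mul, fourierMatrix, Matrix.of_apply, L]
  by_cases hl : leadingForm q T v l = 0
  · simp only [hl, if_true, one_mul]
    split_ifs with h
    · exact ((tendsto_dispersion_of_eq_zero hv ζ w hl).sub_const μ).const_add _
    · exact tendsto_const_nhds
  · simp only [hl, if_false]
    split_ifs with h
    · have h1 := (tendsto_mul_dispersion hv ζ w l).add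
        (hid.mul_const (fourierCoeff q V (l.toLattice - l'.toLattice) - μ))
      rw [zero_mul, add_zero] at h1
      exact h1.congr fun ε => by ring
    · simpa using hid.mul_const (fourierCoeff q V (l.toLattice - l'.toLattice))

/-- The scaling factors and the product of non-zero leading forms do not depend on the potential or
the energy, so they cancel from the two limits. -/
lemma det_boundedBlock_eq {V Y : (Fin d → ℤ) → ℂ} {μ₁ μ₂ : ℂ} {T : Finset (Fin d)}
    {ζ v : Fin d → ℂ} (hv : ∀ j ∈ T, v j ≠ 0)
    (h : ∀ z : Fin d → ℂ, (∀ j ∈ T, z j ≠ 0) →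
      (fourierMatrix q V (T.piecewise z ζ) μ₁).det = (fourierMatrix q Y (T.piecewise z ζ) μ₂).det)
    (w : Fin d → ℂ) :
    (boundedBlock q V μ₁ T ζ v w).det = (boundedBlock q Y μ₂ T ζ v w).det := by
  classical
  have hV := tendsto_det_fourierMatrix (q := q) V μ₁ hv ζ w
  have hY := tendsto_det_fourierMatrix (q := q) Y μ₂ hv ζ w
  have hne : ∀ᶠ ε : ℂ in 𝓝[≠] 0, ∀ j ∈ T, ε⁻¹ * v j + w j ≠ 0 := by
    rw [Filter.eventually_all_finset]
    intro j hj
    have h1 : ∀ᶠ ε : ℂ in 𝓝 0, v j + ε * w j ≠ 0 :=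
      ContinuousAt.eventually_ne (g := fun ε : ℂ => v j + ε * w j) (by fun_prop)
        (by simpa using hv j hj)
    filter_upwards [h1.filter_mono nhdsWithin_le_nhds, self_mem_nhdsWithin] with ε h2 h3 h4
    have h3 : ε ≠ 0 := h3
    apply h2
    have : v j + ε * w j = ε * (ε⁻¹ * v j + w j) := by field_simp
    rw [this, h4, mul_zero]
  have hVY := hY.congr' (hne.mono fun ε hε => congrArg
    ((∏ l : Cell q, if leadingForm q T v l = 0 then 1 else ε) * ·) (h _ hε).symm)
  exact mul_right_cancel₀ (Finset.prod_ne_zero_iff.2 fun l _ => l.2)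
    (tendsto_nhds_unique hV hVY)

end Asymptotics

/-! ### Vanishing of the mixed Fourier coefficients of `Y` -/

section Rigidity

open Matrix

variable {d : ℕ} {q : Fin d → ℕ}

lemma Cell.not_dvd {m : Cell q} {s : Fin d} (hs : m.toLattice s ≠ 0) :
    ¬ (q s : ℤ) ∣ m.toLattice s := by
  intro h
  simp only [Cell.toLattice] at h hs
  exact hs (by exact_mod_cast Nat.eq_zero_of_dvd_of_lt (by exact_mod_cast h) (m s).isLt)

/-- Isospectrality in three quasi-momenta forces the Fourier coefficients of `Y` at frequencies
that are non-zero in two of the coordinates to vanish if those of `V` do. -/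
theorem fourierCoeff_eq_zero_of_det_eq (hq : ∀ j, 0 < q j)
    (hcop : ∀ i j, i ≠ j → (q i).Coprime (q j)) {V Y : (Fin d → ℤ) → ℂ}
    (hY : ∀ n, (Y n).im = 0) {μ₁ μ₂ : ℂ} {ζ : Fin d → ℂ} {s t u : Fin d}
    (hst : s ≠ t) (hsu : s ≠ u) (htu : t ≠ u)
    (hV : ∀ m : Fin d → ℤ, ¬ (q s : ℤ) ∣ m s → ¬ (q t : ℤ) ∣ m t → fourierCoeff q V m = 0)
    (h : ∀ z : Fin d → ℂ, (∀ j ∈ ({s, t, u} : Finset (Fin d)), z j ≠ 0) →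
      (fourierMatrix q V (({s, t, u} : Finset (Fin d)).piecewise z ζ) μ₁).det =
        (fourierMatrix q Y (({s, t, u} : Finset (Fin d)).piecewise z ζ) μ₂).det)
    {m : Cell q} (hs : m.toLattice s ≠ 0) (ht : m.toLattice t ≠ 0) :
    fourierCoeff q Y m.toLattice = 0 := by
  classical
  set T : Finset (Fin d) := {s, t, u} with hT
  have d1 := cellRoot_zpow_ne hq hcop hst hs
  have d2 := cellRoot_zpow_ne hq hcop hsu hs
  have d3 := cellRoot_zpow_ne hq hcop htu ht
  have hsum : ∀ (v : Fin d → ℂ) (l : Cell q), leadingForm q T v l =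
      v s * cellRoot q s ^ l.toLattice s + v t * cellRoot q t ^ l.toLattice t +
        v u * cellRoot q u ^ l.toLattice u := by
    intro v l
    rw [leadingForm, hT, Finset.sum_insert (by simp [hst, hsu]), Finset.sum_insert (by simp [htu]),
      Finset.sum_singleton, add_assoc]
  -- `v` is the cross product of `(ωs, ωt, ωu)` and `(1, 1, 1)`, where `ωj = ρ_j ^ m_j`, so the
  -- leading form vanishes at `m` and at `0`.
  obtain ⟨v, vs, vt, vu⟩ : ∃ v : Fin d → ℂ,
      v s = cellRoot q t ^ m.toLattice t - cellRoot q u ^ m.toLattice u ∧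
      v t = cellRoot q u ^ m.toLattice u - cellRoot q s ^ m.toLattice s ∧
      v u = cellRoot q s ^ m.toLattice s - cellRoot q t ^ m.toLattice t :=
    ⟨fun j => if j = s then cellRoot q t ^ m.toLattice t - cellRoot q u ^ m.toLattice u
      else if j = t then cellRoot q u ^ m.toLattice u - cellRoot q s ^ m.toLattice s
      else cellRoot q s ^ m.toLattice s - cellRoot q t ^ m.toLattice t,
      by simp, by simp [hst.symm], by simp [hsu.symm, htu.symm]⟩
  have hv : ∀ j ∈ T, v j ≠ 0 := by
    intro j hj
    simp only [hT, Finset.mem_insert, Finset.mem_singleton] at hj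
    rcases hj with rfl | rfl | rfl
    · rw [vs]
      exact sub_ne_zero.2 d3
    · rw [vt]
      exact sub_ne_zero.2 d2.symm
    · rw [vu]
      exact sub_ne_zero.2 d1
  have hagree : ∀ l : Cell q, leadingForm q T v l = 0 →
      (l.toLattice s = 0 ∧ l.toLattice t = 0 ∧ l.toLattice u = 0) ∨
        (l s = m s ∧ l t = m t ∧ l u = m u) := by
    intro l hl
    rw [hsum, vs, vt, vu] at hl
    exact agree_of_det_eq_zero hq hcop hst hsu htu hs ht (by linear_combination hl)
  let ι := {l : Cell q // leadingForm q T v l = 0}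
  -- Since `m_s ≠ 0`, the coordinate `s` alone tells the group of `0` from the group of `m`.
  let p : ι → Prop := fun l => l.1.toLattice s = 0
  have hp : ∀ l : ι, p l →
      l.1.toLattice s = 0 ∧ l.1.toLattice t = 0 ∧ l.1.toLattice u = 0 := by
    intro l hl
    rcases hagree l.1 l.2 with h1 | h1
    · exact h1
    · refine absurd ?_ hs
      have h2 : l.1.toLattice s = 0 := hl
      rwa [Cell.toLattice, h1.1] at h2
  have hp' : ∀ l : ι, ¬ p l → l.1.toLattice s = m.toLattice s ∧
      l.1.toLattice t = m.toLattice t ∧ l.1.toLattice u = m.toLattice u := by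
    intro l hl
    rcases hagree l.1 l.2 with h1 | h1
    · exact absurd h1.1 hl
    · simp only [Cell.toLattice, h1.1, h1.2.1, h1.2.2, and_self]
  let o : Cell q := fun j => ⟨0, hq j⟩
  have ho : o.toLattice = 0 := rfl
  have ho' : leadingForm q T v o = 0 := by
    rw [hsum, vs, vt, vu]
    simp [ho]
  have hm' : leadingForm q T v m = 0 := by
    rw [hsum, vs, vt, vu]
    ring
  let A (W : (Fin d → ℤ) → ℂ) (μ : ℂ) := (boundedBlock q W μ T ζ v 0).toBlock p p
  let B (W : (Fin d → ℤ) → ℂ) (μ : ℂ) :=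
    (boundedBlock q W μ T ζ v 0).toBlock (fun l => ¬ p l) (fun l => ¬ p l)
  let C := (boundedBlock q Y μ₂ T ζ v 0).toBlock p (fun l => ¬ p l)
  -- The diagonals differ by one constant, so neither the mean values nor the energies need to be
  -- normalised; the constant is the `δ` of `offDiag_eq_zero_of_det_eq`.
  have hdiag : ∀ l : ι, boundedBlock q V μ₁ T ζ v 0 l l = boundedBlock q Y μ₂ T ζ v 0 l l +
      ((fourierCoeff q V 0 - μ₁) - (fourierCoeff q Y 0 - μ₂)) := by
    intro l
    simp only [boundedBlock, of_apply, sub_self, if_true]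
    ring
  have : Nonempty {l : ι // p l} := ⟨⟨⟨o, ho'⟩, rfl⟩⟩
  have hC : C = 0 := by
    refine offDiag_eq_zero_of_det_eq (A Y μ₂) (A V μ₁) (B Y μ₂) (B V μ₁) C
      ((fourierCoeff q V 0 - μ₁) - (fourierCoeff q Y 0 - μ₂)) ?_ ?_ ?_
    · simp only [A, trace, diag_apply, toBlock_apply, hdiag, Finset.sum_add_distrib,
        Finset.sum_const, Finset.card_univ, nsmul_eq_mul]
    · simp only [B, trace, diag_apply, toBlock_apply, hdiag, Finset.sum_add_distrib,
        Finset.sum_const, Finset.card_univ, nsmul_eq_mul]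
    · intro x y
      have d1' := sub_ne_zero.2 d1
      -- Cramer's rule in `w_s`, `w_t` with `w_u = 0`, solvable because `ωs ≠ ωt`.
      obtain ⟨w, hw0, hw1⟩ : ∃ w : Fin d → ℂ, w s + w t + w u = x ∧
          w s * cellRoot q s ^ m.toLattice s + w t * cellRoot q t ^ m.toLattice t +
            w u * cellRoot q u ^ m.toLattice u = y := by
        refine ⟨fun j => if j = s then (y - cellRoot q t ^ m.toLattice t * x) /
            (cellRoot q s ^ m.toLattice s - cellRoot q t ^ m.toLattice t)
          else if j = t then (cellRoot q s ^ m.toLattice s * x - y) /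
            (cellRoot q s ^ m.toLattice s - cellRoot q t ^ m.toLattice t) else 0, ?_, ?_⟩
        · simp only [if_true, hst.symm, hsu.symm, htu.symm, if_false]
          field_simp
          ring
        · simp only [if_true, hst.symm, hsu.symm, htu.symm, if_false]
          field_simp
          ring
      have hx : ∀ l : ι, p l → leadingForm q T w l.1 = x := by
        intro l hl
        obtain ⟨h1, h2, h3⟩ := hp l hl
        rw [hsum, h1, h2, h3, ← hw0]
        simp
      have hy : ∀ l : ι, ¬ p l → leadingForm q T w l.1 = y := by
        intro l hl
        obtain ⟨h1, h2, h3⟩ := hp' l hl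
        rw [hsum, h1, h2, h3, hw1]
      have h0 : ∀ l : ι, leadingForm q T 0 l.1 = 0 := fun l => by simp [hsum]
      have hA : ∀ W μ, (boundedBlock q W μ T ζ v w).toBlock p p = scalar _ x + A W μ := by
        intro W μ
        ext l l'
        simp only [A, toBlock_apply, boundedBlock, of_apply, h0, hx l.1 l.2, Matrix.add_apply,
          scalar_apply, diagonal_apply, Subtype.ext_iff]
        split_ifs <;> ring
      have hB : ∀ W μ, (boundedBlock q W μ T ζ v w).toBlock (fun l => ¬ p l) (fun l => ¬ p l) =
          scalar _ y + B W μ := by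
        intro W μ
        ext l l'
        simp only [B, toBlock_apply, boundedBlock, of_apply, h0, hy l.1 l.2, Matrix.add_apply,
          scalar_apply, diagonal_apply, Subtype.ext_iff]
        split_ifs <;> ring
      have hCw : (boundedBlock q Y μ₂ T ζ v w).toBlock p (fun l => ¬ p l) = C := by
        ext l l'
        have : l.1 ≠ l'.1 := fun h => l'.2 (h ▸ l.2)
        simp only [C, toBlock_apply, boundedBlock, of_apply, this, if_false]
      have hCw' : (boundedBlock q Y μ₂ T ζ v w).toBlock (fun l => ¬ p l) p = Cᴴ := by
        ext l l'
        have h1 : l.1 ≠ l'.1 := fun h => l.2 (h ▸ l'.2)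
        simp only [C, toBlock_apply, boundedBlock, of_apply, h1, h1.symm, if_false,
          conjTranspose_apply, add_zero, star_fourierCoeff Y hY, neg_sub]
      -- A frequency of the second group minus one of the first agrees with `m` in the coordinates
      -- `s` and `t`, so `hV` kills the lower left block.
      have hVblock : (boundedBlock q V μ₁ T ζ v w).det =
          (scalar _ x + A V μ₁).det * (scalar _ y + B V μ₁).det := by
        rw [twoBlockTriangular_det _ p, ← hA, ← hB]
        · rfl
        · intro l hl l' hl'
          have h1 : l ≠ l' := fun h => hl (h ▸ hl')
          obtain ⟨a1, a2, -⟩ := hp' l hl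
          obtain ⟨b1, b2, -⟩ := hp l' hl'
          simp only [boundedBlock, of_apply, h1, if_false, add_zero]
          apply hV
          · rw [Pi.sub_apply, a1, b1, sub_zero]
            exact Cell.not_dvd hs
          · rw [Pi.sub_apply, a2, b2, sub_zero]
            exact Cell.not_dvd ht
      rw [← hVblock, det_boundedBlock_eq hv h w, det_toBlock _ p, hA, hB, hCw, hCw']
  have hentry := congrFun (congrFun hC ⟨⟨o, ho'⟩, rfl⟩) ⟨⟨m, hm'⟩, hs⟩
  have hom : (⟨o, ho'⟩ : ι) ≠ ⟨m, hm'⟩ := fun h => hs (by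
    have h1 : o = m := congrArg Subtype.val h
    rw [← h1, ho, Pi.zero_apply])
  simp only [C, toBlock_apply, boundedBlock, of_apply, hom, if_false, add_zero, Matrix.zero_apply, ho,
    zero_sub] at hentry
  rw [← star_fourierCoeff Y hY] at hentry
  exact star_eq_zero.1 hentry

/-- Three free quasi-momenta suffice: every other one, in `S` or not, is frozen at its value in
`k₀`, and real quasi-momenta sweep out the unit torus in the remaining three. -/
theorem fourierCoeff_eq_zero_of_isospectral (hq : ∀ j, 0 < q j)
    (hcop : ∀ i j, i ≠ j → (q i).Coprime (q j)) {V Y : (Fin d → ℤ) → ℂ}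
    (hY : ∀ n, (Y n).im = 0) {μ₁ μ₂ : ℂ} {S : Finset (Fin d)}
    (hiso : IsGenPartiallyFermiIsospectral q S μ₁ μ₂ V Y) (hS : 3 ≤ S.card) {s t : Fin d}
    (hsS : s ∈ S) (htS : t ∈ S) (hst : s ≠ t)
    (hV : ∀ m : Fin d → ℤ, ¬ (q s : ℤ) ∣ m s → ¬ (q t : ℤ) ∣ m t → fourierCoeff q V m = 0)
    {m : Cell q} (hs : m.toLattice s ≠ 0) (ht : m.toLattice t ≠ 0) :
    fourierCoeff q Y m.toLattice = 0 := by
  obtain ⟨-, k₀, hk⟩ := hiso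
  obtain ⟨u, huS, hus, hut⟩ : ∃ u ∈ S, u ≠ s ∧ u ≠ t := by
    obtain ⟨u, hu⟩ : ((S.erase s).erase t).Nonempty := Finset.card_pos.1 (by
      rw [Finset.card_erase_of_mem (Finset.mem_erase.2 ⟨hst.symm, htS⟩),
        Finset.card_erase_of_mem hsS]
      lia)
    simp only [Finset.mem_erase] at hu
    exact ⟨u, hu.2.2, hu.2.1, hu.1⟩
  refine fourierCoeff_eq_zero_of_det_eq hq hcop hY (μ₁ := μ₁) (μ₂ := μ₂)
    (ζ := quasiMultiplier q k₀) hst hus.symm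
    hut.symm hV ?_ hs ht
  refine det_fourierMatrix_eq_of_torus fun z hz => ?_
  have hex : ∀ j, ∃ x : ℝ, ‖z j‖ = 1 → z j = Complex.exp (2 * Real.pi * Complex.I * x / q j) := by
    intro j
    have hqj : (q j : ℂ) ≠ 0 := Nat.cast_ne_zero.2 (hq j).ne'
    refine ⟨(z j).arg / (2 * Real.pi) * q j, fun h => ?_⟩
    have h1 := Complex.norm_mul_exp_arg_mul_I (z j)
    rw [h, Complex.ofReal_one, one_mul] at h1
    have hpi : (Real.pi : ℂ) ≠ 0 := Complex.ofReal_ne_zero.2 Real.pi_ne_zero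
    conv_lhs => rw [← h1]
    congr 1
    push_cast
    field_simp
  choose x hx using hex
  set T : Finset (Fin d) := {s, t, u}
  have hTS : ∀ j ∈ T, j ∈ S := by
    intro j hj
    simp only [T, Finset.mem_insert, Finset.mem_singleton] at hj
    rcases hj with rfl | rfl | rfl <;> assumption
  have hz' : T.piecewise z (quasiMultiplier q k₀) = quasiMultiplier q (T.piecewise x k₀) := by
    funext j
    by_cases hj : j ∈ T
    · simp only [quasiMultiplier, Finset.piecewise_eq_of_mem _ _ _ hj]
      exact hx j (hz j hj)
    · simp only [quasiMultiplier, Finset.piecewise_eq_of_notMem _ _ _ hj]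
  rw [hz', ← floquetDet_eq_det_fourierMatrix hq, ← floquetDet_eq_det_fourierMatrix hq]
  exact hk _ fun j hj => Finset.piecewise_eq_of_notMem _ _ _ fun h => hj (hTS j h)

end Rigidity

/-! ### Fourier expansion of periodic functions -/

section Separability

variable {d : ℕ} {q : Fin d → ℕ}

lemma fourierCoeff_sum {ι : Type*} (s : Finset ι) (F : ι → (Fin d → ℤ) → ℂ) (m : Fin d → ℤ) :
    fourierCoeff q (fun n => ∑ i ∈ s, F i n) m = ∑ i ∈ s, fourierCoeff q (F i) m := by
  simp only [fourierCoeff, Finset.sum_mul, ← Finset.mul_sum]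
  rw [Finset.sum_comm]

lemma apply_add_mul_single_of_isPeriodic {V : (Fin d → ℤ) → ℂ} (hV : IsPeriodic q V)
    (j : Fin d) (a : ℤ) (n : Fin d → ℤ) : V (n + Pi.single j (a * q j)) = V n := by
  induction a with
  | zero => simp
  | succ a ih =>
    rw [add_mul, one_mul, Pi.single_add, ← add_assoc, hV, ih]
  | pred a ih =>
    rw [← hV j, add_assoc, ← Pi.single_add, sub_mul, one_mul, sub_add_cancel, ih]

lemma apply_cellMod (hq : ∀ j, 0 < q j) {V : (Fin d → ℤ) → ℂ} (hV : IsPeriodic q V)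
    (n : Fin d → ℤ) : V (cellMod hq n).toLattice = V n := by
  have h : ∀ (s : Finset (Fin d)) (n : Fin d → ℤ) (c : Fin d → ℤ),
      V (n + ∑ j ∈ s, Pi.single j (c j * q j)) = V n := by
    intro s
    induction s using Finset.induction_on with
    | empty => simp
    | insert j s hj ih =>
      intro n c
      rw [Finset.sum_insert hj, ← add_assoc, ih, apply_add_mul_single_of_isPeriodic hV]
  rw [← h Finset.univ (cellMod hq n).toLattice fun j => n j / q j]
  congr 1
  funext j
  rw [Pi.add_apply, Finset.sum_apply, cellMod_toLattice]
  simp only [Finset.sum_pi_single, Finset.mem_univ, if_true]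
  rw [mul_comm]
  exact Int.emod_add_mul_ediv _ _

lemma latticeChar_cellMod (hq : ∀ j, 0 < q j) (m n : Fin d → ℤ) :
    latticeChar q m (cellMod hq n).toLattice = latticeChar q m n := by
  refine Finset.prod_congr rfl fun j _ => ?_
  have h : m j * n j = m j * (n j % q j) + q j * (m j * (n j / q j)) := by
    conv_lhs => rw [← Int.mul_ediv_add_emod (n j) (q j)]
    ring
  rw [cellMod_toLattice, h, zpow_add₀ (cellRoot_ne_zero j), zpow_mul _ (q j : ℤ), zpow_natCast,
    (cellRoot_isPrimitiveRoot hq j).pow_eq_one, one_zpow, mul_one]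

/-- The Fourier expansion of a periodic function. -/
theorem eq_sum_fourierCoeff (hq : ∀ j, 0 < q j) {V : (Fin d → ℤ) → ℂ} (hV : IsPeriodic q V)
    (n : Fin d → ℤ) :
    V n = ∑ l : Cell q, fourierCoeff q V l.toLattice * latticeChar q l.toLattice n := by
  have h := sum_fourierCoeff_sub hq V 0 (cellMod hq n)
  simp only [sub_zero, latticeChar_cellMod, apply_cellMod hq hV] at h
  rw [h]
  simp [latticeChar]

end Separability

/-! ### Separability in terms of Fourier coefficients -/

section Blocks

variable {p : ℕ} {ds : Fin (p + 1) → ℕ} {q : Fin (∑ j, ds j) → ℕ}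

lemma blockIndex_ne {i m : Fin (p + 1)} (h : i ≠ m) (a : Fin (ds i)) (b : Fin (ds m)) :
    blockIndex ds i a ≠ blockIndex ds m b := fun h' =>
  h (congrArg Sigma.fst (finSigmaFinEquiv.injective h'))

lemma exists_blockIndex_eq (j : Fin (∑ j, ds j)) : ∃ m a, blockIndex ds m a = j :=
  ⟨(finSigmaFinEquiv.symm j).1, (finSigmaFinEquiv.symm j).2,
    finSigmaFinEquiv.apply_symm_apply j⟩

lemma block_update_of_ne {i m : Fin (p + 1)} (h : m ≠ i) (a : Fin (ds i))
    (n : Fin (∑ j, ds j) → ℤ) (x : ℤ) :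
    block ds (Function.update n (blockIndex ds i a) x) m = block ds n m := by
  funext b
  exact Function.update_of_ne (blockIndex_ne h b a) _ _

/-- The mixed Fourier coefficients of a separable function vanish. -/
lemma IsOplusSeparable.fourierCoeff_eq_zero (hq : ∀ j, 0 < q j)
    {V : (Fin (∑ j, ds j) → ℤ) → ℂ} (hV : IsOplusSeparable ds V) {i m : Fin p} (him : i ≠ m)
    (a : Fin (ds i.castSucc)) (b : Fin (ds m.castSucc)) (l : Fin (∑ j, ds j) → ℤ)
    (ha : ¬ (q (blockIndex ds i.castSucc a) : ℤ) ∣ l (blockIndex ds i.castSucc a))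
    (hb : ¬ (q (blockIndex ds m.castSucc b) : ℤ) ∣ l (blockIndex ds m.castSucc b)) :
    fourierCoeff q V l = 0 := by
  obtain ⟨F, hF⟩ := hV
  rw [funext hF, fourierCoeff_sum]
  refine Finset.sum_eq_zero fun j _ => ?_
  have hlast : ∀ i : Fin p, Fin.last p ≠ i.castSucc := fun i => (Fin.castSucc_lt_last i).ne'
  -- No summand sees both blocks: the summand `j = i` is independent of the coordinate in block `m`,
  -- and every other one of the coordinate in block `i`.
  by_cases hj : j = i
  · refine fourierCoeff_eq_zero_of_indep hq _ _ (fun n x => ?_) l hb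
    rw [block_update_of_ne (hlast m), block_update_of_ne]
    rw [hj]
    exact fun h => him (Fin.castSucc_injective p h)
  · refine fourierCoeff_eq_zero_of_indep hq _ _ (fun n x => ?_) l ha
    rw [block_update_of_ne (hlast i), block_update_of_ne]
    exact fun h => hj (Fin.castSucc_injective p h)

/-- A periodic function whose mixed Fourier coefficients vanish is separable. -/
theorem isOplusSeparable_of_fourierCoeff (hp : 0 < p) (hq : ∀ j, 0 < q j)
    {Y : (Fin (∑ j, ds j) → ℤ) → ℂ} (hY : IsPeriodic q Y)
    (h : ∀ i m : Fin p, i < m → ∀ (a : Fin (ds i.castSucc)) (b : Fin (ds m.castSucc))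
      (l : Cell q), l.toLattice (blockIndex ds i.castSucc a) ≠ 0 →
        l.toLattice (blockIndex ds m.castSucc b) ≠ 0 → fourierCoeff q Y l.toLattice = 0) :
    IsOplusSeparable ds Y := by
  classical
  have hne : ∀ i m : Fin p, i ≠ m → ∀ (a : Fin (ds i.castSucc)) (b : Fin (ds m.castSucc))
      (l : Cell q), l.toLattice (blockIndex ds i.castSucc a) ≠ 0 →
        l.toLattice (blockIndex ds m.castSucc b) ≠ 0 → fourierCoeff q Y l.toLattice = 0 := by
    intro i m him a b l ha hb
    rcases lt_or_gt_of_ne him with h1 | h1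
    · exact h i m h1 a b l ha hb
    · exact h m i h1 b a l hb ha
  -- Each frequency is assigned to one of the first `p` blocks, outside of which (the last block
  -- aside) it vanishes if its coefficient is non-zero. Frequencies supported in the last block go
  -- to block `0` by default, hence `0 < p`.
  have hex : ∀ l : Cell q, ∃ i : Fin p, fourierCoeff q Y l.toLattice ≠ 0 →
      ∀ m : Fin p, m ≠ i → ∀ b, l.toLattice (blockIndex ds m.castSucc b) = 0 := by
    intro l
    by_cases hl : ∃ (i : Fin p) (a : Fin (ds i.castSucc)),
        l.toLattice (blockIndex ds i.castSucc a) ≠ 0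
    · obtain ⟨i, a, ha⟩ := hl
      refine ⟨i, fun h0 m hm b => ?_⟩
      by_contra hb
      exact h0 (hne i m hm.symm a b l ha hb)
    · push Not at hl
      exact ⟨⟨0, hp⟩, fun _ m _ b => hl m b⟩
  choose c hc using hex
  let f (i : Fin p) (n : Fin (∑ j, ds j) → ℤ) : ℂ :=
    ∑ l : Cell q with c l = i, fourierCoeff q Y l.toLattice * latticeChar q l.toLattice n
  -- In the terms assigned to block `i`, either the coefficient is zero or the character involves
  -- only block `i` and the last one; so the partial sum descends to a function of these two blocks.
  have hf : ∀ i, Function.FactorsThrough (f i)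
      fun n => (block ds n i.castSucc, block ds n (Fin.last p)) := by
    intro i n n' hn
    obtain ⟨h1, h2⟩ := Prod.mk.inj hn
    refine Finset.sum_congr rfl fun l hl => ?_
    obtain rfl : c l = i := (Finset.mem_filter.1 hl).2
    by_cases h0 : fourierCoeff q Y l.toLattice = 0
    · rw [h0, zero_mul, zero_mul]
    · congr 1
      refine Finset.prod_congr rfl fun j _ => ?_
      obtain ⟨m, b, rfl⟩ := exists_blockIndex_eq j
      induction m using Fin.lastCases with
      | last => rw [show n (blockIndex ds _ b) = n' (blockIndex ds _ b) from congrFun h2 b]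
      | cast m =>
        by_cases hm : m = c l
        · subst hm
          rw [show n (blockIndex ds _ b) = n' (blockIndex ds _ b) from congrFun h1 b]
        · rw [hc l h0 m hm b, zero_mul, zero_mul]
  choose F hF using fun i => (Function.factorsThrough_iff _).1 (hf i)
  refine ⟨fun i x y => F i (x, y), fun n => ?_⟩
  rw [eq_sum_fourierCoeff hq hY, ← Finset.sum_fiberwise _ c]
  exact Finset.sum_congr rfl fun i _ => congrFun (hF i) n

end Blocks

end DiscreteFloquet

end

theorem mainTheorem3 (p : ℕ) (hp : 2 ≤ p) (ds : Fin (p + 1) → ℕ) (hds : ∀ j, 1 ≤ ds j)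
    (q : Fin (∑ j, ds j) → ℕ) (hq : ∀ j, 0 < q j)
    (hcop : ∀ i j, i ≠ j → Nat.Coprime (q i) (q j))
    (V Y : (Fin (∑ j, ds j) → ℤ) → ℂ)
    (hVreal : ∀ n, (V n).im = 0) (hYreal : ∀ n, (Y n).im = 0)
    (hVper : DiscreteFloquet.IsPeriodic q V) (hYper : DiscreteFloquet.IsPeriodic q Y)
    (hVsep : DiscreteFloquet.IsOplusSeparable ds V)
    (hiso : ∀ i m : Fin p, i < m → ∀ (a : Fin (ds i.castSucc)) (b : Fin (ds m.castSucc)),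
      ∃ (μ₁ μ₂ : ℂ) (S : Finset (Fin (∑ j, ds j))),
        DiscreteFloquet.blockIndex ds i.castSucc a ∈ S ∧
        DiscreteFloquet.blockIndex ds m.castSucc b ∈ S ∧
        3 ≤ S.card ∧
        DiscreteFloquet.IsGenPartiallyFermiIsospectral q S μ₁ μ₂ V Y) :
    DiscreteFloquet.IsOplusSeparable ds Y := by
  refine DiscreteFloquet.isOplusSeparable_of_fourierCoeff (by lia) hq hYper
    fun i m him a b l ha hb => ?_
  obtain ⟨μ₁, μ₂, S, hs, ht, hS, hVY⟩ := hiso i m him a b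
  exact DiscreteFloquet.fourierCoeff_eq_zero_of_isospectral hq hcop hYreal hVY hS hs ht
    (DiscreteFloquet.blockIndex_ne (fun h => him.ne (Fin.castSucc_injective p h)) a b)
    (fun l' => hVsep.fourierCoeff_eq_zero hq him.ne a b l') ha hb
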